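/- An MDP $\mathcal M=(S,s_1,\mathcal A,\mathcal P)$ has a finite state set $S$, an initial state $s_1$, a finite action set $\mathcal A$, a nonempty set $\mathcal A(s)\subseteq\mathcal A$ of available actions for each $s\in S$, and $\mathcal P_{s,a,s'}\in[0,1]$ with $\sum_{s'}\mathcal P_{s,a,s'}=1$ for $a\in\mathcal A(s)$. A policy $\pi=(d_1,d_2,\dots)\in\Pi(\mathcal M)$ is a sequence of maps such that each $d_t(s,\cdot)$ is a probability distribution on $\mathcal A(s)$. For $B\subseteq S$, $\Xi(\mathcal M,B)\subseteq\Pi(\mathcal M)$ is the set of policies that maximize, over $\Pi(\mathcal M)$, the probability of reaching $B$ from $s_1$ (that is, that $s_t\in B$ for some $t\ge 1$). Let $B\subseteq S$ be a set of absorbing states ($\mathcal P_{s,a,s}=1$ for $s\in B$, $a\in\mathcal A(s)$), let $c:S\times\mathcal A\to\mathbb R_{\ge 0}$ and $\beta\in(0,1)$. Let $x_s$ be the maximal probability, over $\Pi(\mathcal M)$, of reaching $B$ from $s$; let $S_0$ be the set of states with $x_s=0$, $S_r=S\setminus(B\cup S_0)$ and $\mathcal A_{\max}(s)=\{a\in\mathcal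 A(s): x_s=\sum_{s'}\mathcal P_{s,a,s'}x_{s'}\}$. The cleaned-up MDP $\mathcal M'$ is obtained from $\mathcal M$ by removing the actions in $\mathcal A(s)\setminus\mathcal A_{\max}(s)$ from each $s\in S_r$. Let $y\in\mathbb R^S$ be the unique solution of $y_s=\min_{a\in\mathcal A_{\max}(s)}\{c(s,a)+\beta\sum_{s'}\mathcal P_{s,a,s'}y_{s'}\}$, $s\in S$, and let $\mathcal A_{opt}(s)$ be the set of $a\in\mathcal A_{\max}(s)$ that attain this minimum. The modified MDP $\overline{\mathcal M}'$ is obtained from $\mathcal M'$ by removing the actions in $\mathcal A_{\max}(s)\setminus\mathcal A_{opt}(s)$ from each $s\in S$. Let $\overline x_s$ be the maximal probability, over $\Pi(\overline{\mathcal M}')$, of reaching $B$ from $s$. Then $x$ is the (componentwise) least nonnegative vector with $x_s=1$ for $s\in B$, $x_s=0$ for $s\in S_0$ and $x_s=\max_{a\in\mathcal A(s)}\sum_{s'}\mathcal P_{s,a,s'}x_{s'}$ for $s\in S_r$; $\overline x$ is the least nonnegative vector that satisfies the same system with $\mathcal A_{opt}(s)$ in place of $\mathcal A(s)$; and there exists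 a policy $\pi\in\Pi(\overline{\mathcal M}')$ with $\pi\in\Xi(\mathcal M',B)$ if and only if $\overline x_{s_1}=x_{s_1}$. -/

import Mathlib

open MeasureTheory ProbabilityTheory
open scoped NNReal ENNReal

/-- A Markov decision process with finite state space `S`, actions in `A`, initial state `start`,
finite sets `act s` of available actions and transition probabilities `P s a s'`. -/
structure MDP (S A : Type*) [Fintype S] where
  /-- the initial state -/
  start : S
  /-- the actions available in a state -/
  act : S → Finset A
  /-- the transition function -/
  P : S → A → S → ℝ
  P_nonneg : ∀ s a s', 0 ≤ P s a s'
  P_le_one : ∀ s a s', P s a s' ≤ 1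
  P_sum : ∀ s, ∀ a ∈ act s, ∑ s', P s a s' = 1

namespace MDP

variable {S A : Type*} [Fintype S]

/-- The (randomized, Markovian) policies of `M`: sequences `d 0, d 1, …` of decision rules, where
`d t s` is a probability distribution on the actions available in `s`. -/
def policies (M : MDP S A) : Set (ℕ → S → A → ℝ) :=
  {d | ∀ t s, (∀ a, 0 ≤ d t s a) ∧ (∀ a, a ∉ M.act s → d t s a = 0) ∧
    ∑ a ∈ M.act s, d t s a = 1}

/-- The distribution of the next state when a policy is in state `s` at time `t`. -/
noncomputable def step (M : MDP S A) (π : M.policies) (t : ℕ) (s : S) : PMF S :=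
  PMF.ofFintype (fun s' => ENNReal.ofReal (∑ a ∈ M.act s, π.1 t s a * M.P s a s')) (by
    rw [← ENNReal.ofReal_sum_of_nonneg (fun s' _ => Finset.sum_nonneg fun a _ =>
      mul_nonneg ((π.2 t s).1 a) (M.P_nonneg s a s')), Finset.sum_comm]
    have h : ∀ a ∈ M.act s, ∑ s', π.1 t s a * M.P s a s' = π.1 t s a := fun a ha => by
      rw [← Finset.mul_sum, M.P_sum s a ha, mul_one]
    rw [Finset.sum_congr rfl h, (π.2 t s).2.2, ENNReal.ofReal_one])

/-- The law of the state at time `t + 1`, given the states up to time `t`. -/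
noncomputable def stepKernel [MeasurableSpace S] [DiscreteMeasurableSpace S]
    (M : MDP S A) (π : M.policies) (t : ℕ) : Kernel ((_ : Finset.Iic t) → S) S :=
  Kernel.comap (Kernel.ofFunOfCountable fun s => (M.step π t s).toMeasure)
    (fun h => h ⟨t, Finset.mem_Iic.2 le_rfl⟩) (measurable_pi_apply _)

instance [MeasurableSpace S] [DiscreteMeasurableSpace S] (M : MDP S A) (π : M.policies) (t : ℕ) :
    IsMarkovKernel (M.stepKernel π t) := by
  constructor
  intro h
  rw [stepKernel, Kernel.comap_apply]
  exact PMF.toMeasure.isProbabilityMeasure _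

/-- The probability measure on the state paths generated by `π` from the state `s`. -/
noncomputable def pathMeasure [MeasurableSpace S] [DiscreteMeasurableSpace S]
    (M : MDP S A) (π : M.policies) (s : S) : Measure (ℕ → S) :=
  Kernel.trajMeasure (X := fun _ => S) (Measure.dirac s) (M.stepKernel π)

/-- The probability that the paths generated by `π` from `s` reach `B`. -/
noncomputable def reachProb [MeasurableSpace S] [DiscreteMeasurableSpace S]
    (M : MDP S A) (B : Set S) (π : M.policies) (s : S) : ℝ :=
  (M.pathMeasure π s).real {ω | ∃ t, ω t ∈ B}

/-- The policies of `M` that maximize, over all policies of `M`, the probability of reaching `B`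
from the initial state. -/
def maxReachPolicies [MeasurableSpace S] [DiscreteMeasurableSpace S]
    (M : MDP S A) (B : Set S) : Set (ℕ → S → A → ℝ) :=
  {d | ∃ h : d ∈ M.policies, ∀ π : M.policies,
    M.reachProb B π M.start ≤ M.reachProb B ⟨d, h⟩ M.start}

/-- The vector `x`: the maximal probability of reaching `B` from `s`, over all policies of `M`. -/
noncomputable def maxReach [MeasurableSpace S] [DiscreteMeasurableSpace S]
    (M : MDP S A) (B : Set S) (s : S) : ℝ :=
  ⨆ π : M.policies, M.reachProb B π s

/-- The states from which `B` is reached with probability zero under every policy. -/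
def zeroStates [MeasurableSpace S] [DiscreteMeasurableSpace S]
    (M : MDP S A) (B : Set S) : Set S :=
  {s | ∀ π : M.policies, M.reachProb B π s = 0}

/-- The actions in `s` that preserve the maximal probability of reaching `B`. -/
noncomputable def maxActions [MeasurableSpace S] [DiscreteMeasurableSpace S]
    (M : MDP S A) (B : Set S) (s : S) : Finset A :=
  open Classical in
  (M.act s).filter fun a => M.maxReach B s = ∑ s', M.P s a s' * M.maxReach B s'

open Classical in
/-- The MDP obtained from `M` by removing, from each state `s`, the actions `a` with `R s a`. -/
noncomputable def remove (M : MDP S A) (R : S → A → Prop) : MDP S A where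
  start := M.start
  act s := (M.act s).filter fun a => ¬ R s a
  P := M.P
  P_nonneg := M.P_nonneg
  P_le_one := M.P_le_one
  P_sum s a ha := M.P_sum s a (Finset.filter_subset _ _ ha)

/-- The cleaned-up MDP. -/
noncomputable def cleaned [MeasurableSpace S] [DiscreteMeasurableSpace S]
    (M : MDP S A) (B : Set S) : MDP S A :=
  M.remove fun s a => s ∉ B ∪ M.zeroStates B ∧ a ∉ M.maxActions B s

/-- The dynamic programming operator of the discounted cost, with the minimum taken over
`M.maxActions B s`. -/
noncomputable def costOp [MeasurableSpace S] [DiscreteMeasurableSpace S]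
    (M : MDP S A) (B : Set S) (c : S → A → ℝ≥0) (β : ℝ) (z : S → ℝ) (s : S) : ℝ :=
  ⨅ a : M.maxActions B s, ((c s a : ℝ) + β * ∑ s', M.P s a s' * z s')

lemma costOp_isLeast [MeasurableSpace S] [DiscreteMeasurableSpace S]
    (M : MDP S A) (B : Set S) (c : S → A → ℝ≥0) (β : ℝ) (z : S → ℝ) (s : S)
    (hs : (M.maxActions B s).Nonempty) :
    IsLeast ((fun a => (c s a : ℝ) + β * ∑ s', M.P s a s' * z s') '' M.maxActions B s)
      (M.costOp B c β z s) := by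
  have : Nonempty (M.maxActions B s) := hs.to_subtype
  constructor
  · obtain ⟨a, ha⟩ := exists_eq_ciInf_of_finite
      (f := fun a : M.maxActions B s => ((c s a : ℝ) + β * ∑ s', M.P s a s' * z s'))
    exact ⟨a, a.2, ha⟩
  · rintro _ ⟨a, ha, rfl⟩
    exact ciInf_le (Set.finite_range _).bddBelow (⟨a, ha⟩ : M.maxActions B s)

lemma costOp_le [MeasurableSpace S] [DiscreteMeasurableSpace S]
    (M : MDP S A) (B : Set S) (c : S → A → ℝ≥0) {β : ℝ} (hβ : 0 ≤ β) (z w : S → ℝ) (s : S) :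
    M.costOp B c β z s ≤ M.costOp B c β w s + β * dist z w := by
  rcases (M.maxActions B s).eq_empty_or_nonempty with h | h
  · have : IsEmpty (M.maxActions B s) := ⟨fun a => by simpa [h] using a.2⟩
    have : 0 ≤ β * dist z w := mul_nonneg hβ dist_nonneg
    simpa [costOp, Real.iInf_of_isEmpty] using this
  · obtain ⟨a, ha, hw⟩ := (M.costOp_isLeast B c β w s h).1
    refine ((M.costOp_isLeast B c β z s h).2 ⟨a, ha, rfl⟩).trans ?_
    rw [← hw]
    have hP := M.P_sum s a (Finset.mem_filter.1 ha).1
    have hd : ∑ s', M.P s a s' * z s' ≤ ∑ s', M.P s a s' * w s' + dist z w := by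
      calc ∑ s', M.P s a s' * z s' ≤ ∑ s', M.P s a s' * (w s' + dist z w) := by
            refine Finset.sum_le_sum fun s' _ => mul_le_mul_of_nonneg_left ?_ (M.P_nonneg s a s')
            have := (le_abs_self _).trans ((Real.dist_eq _ _).symm.trans_le
              (dist_le_pi_dist z w s'))
            linarith
        _ = _ := by
            simp_rw [mul_add]
            rw [Finset.sum_add_distrib, ← Finset.sum_mul, hP, one_mul]
    have := mul_le_mul_of_nonneg_left hd hβ
    simp only
    linarith

lemma costOp_contracting [MeasurableSpace S] [DiscreteMeasurableSpace S]
    (M : MDP S A) (B : Set S) (c : S → A → ℝ≥0) (β : Set.Ioo (0 : ℝ) 1) :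
    ContractingWith ⟨β, β.2.1.le⟩ (M.costOp B c β) := by
  refine ⟨NNReal.coe_lt_coe.1 β.2.2, LipschitzWith.of_dist_le_mul fun z w => ?_⟩
  have h0 : (0 : ℝ) ≤ β * dist z w := mul_nonneg β.2.1.le dist_nonneg
  refine (dist_pi_le_iff h0).2 fun s => ?_
  have h1 := M.costOp_le B c β.2.1.le z w s
  have h2 := M.costOp_le B c β.2.1.le w z s
  rw [dist_comm w z] at h2
  rw [Real.dist_eq, abs_le]
  constructor <;> linarith

/-- The vector `y`: the unique solution of the dynamic programming equation
`y s = min_{a ∈ maxActions s} (c s a + β ∑ s', P s a s' * y s')`. -/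
noncomputable def costValue [MeasurableSpace S] [DiscreteMeasurableSpace S]
    (M : MDP S A) (B : Set S) (c : S → A → ℝ≥0) (β : Set.Ioo (0 : ℝ) 1) : S → ℝ :=
  ContractingWith.fixedPoint (M.costOp B c β) (M.costOp_contracting B c β)

lemma costValue_iff [MeasurableSpace S] [DiscreteMeasurableSpace S]
    (M : MDP S A) (B : Set S) (c : S → A → ℝ≥0) (β : Set.Ioo (0 : ℝ) 1) (y : S → ℝ) :
    y = M.costValue B c β ↔ ∀ s, y s = M.costOp B c β y s := by
  constructor
  · rintro rfl s
    exact (congrFun (M.costOp_contracting B c β).fixedPoint_isFixedPt s).symm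
  · intro h
    exact (M.costOp_contracting B c β).fixedPoint_unique (funext fun s => (h s).symm)

/-- The discount-optimal actions in `s`. -/
noncomputable def optActions [MeasurableSpace S] [DiscreteMeasurableSpace S]
    (M : MDP S A) (B : Set S) (c : S → A → ℝ≥0) (β : Set.Ioo (0 : ℝ) 1) (s : S) : Finset A :=
  open Classical in
  (M.maxActions B s).filter fun a =>
    M.costValue B c β s = c s a + β * ∑ s', M.P s a s' * M.costValue B c β s'

/-- The modified MDP: the cleaned-up MDP without the actions that are not discount-optimal. -/
noncomputable def modified [MeasurableSpace S] [DiscreteMeasurableSpace S]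
    (M : MDP S A) (B : Set S) (c : S → A → ℝ≥0) (β : Set.Ioo (0 : ℝ) 1) : MDP S A :=
  (M.cleaned B).remove fun s a => a ∈ M.maxActions B s ∧ a ∉ M.optActions B c β s

/-- The nonnegative solutions `z` of the reachability equations of `M`, with the maximum taken over
the action sets `K s`: `z s = 1` on `B`, `z s = 0` on the states of `M` that cannot reach `B`, and
`z s = max_{a ∈ K s} ∑ s', P s a s' * z s'` elsewhere. -/
def reachSolutions [MeasurableSpace S] [DiscreteMeasurableSpace S]
    (M : MDP S A) (B : Set S) (K : S → Finset A) : Set (S → ℝ) :=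
  {z | (∀ s, 0 ≤ z s) ∧ (∀ s ∈ B, z s = 1) ∧ (∀ s ∈ M.zeroStates B, z s = 0) ∧
    ∀ s, s ∉ B ∪ M.zeroStates B →
      IsGreatest ((fun a => ∑ s', M.P s a s' * z s') '' K s) (z s)}

end MDP

/-! Because `B` is absorbing, having reached `B` by time `n` is almost surely the same as being in
`B` at time `n`. So `reachProb` is the limit of the finite-horizon probabilities `hitVec`, which
obey a backward recursion. Value iteration dominates `hitVec` for every policy, and its limit
`reachLim B 1` lies below every nonnegative supersolution of the optimality equations.

The limit must also be attained. A rule greedy for the undiscounted equations may circulate forever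
among states of equal value, so each step is discounted by `l < 1`: then a greedy stationary rule
does attain the discounted value. There are finitely many such rules, so one of them is greedy for
discounts arbitrarily close to 1, and `l → 1` makes it optimal from every state
(`Absorbing.exists_stationary`). Hence `maxReach` is `reachLim B 1`, the least solution.

For the equivalence, an optimal stationary rule of `M` uses only actions in `maxActions` and so
survives the clean-up: the cleaned and original MDPs have the same maximum. The maximum of the
modified MDP is attained too, so it contains a policy optimal for the cleaned MDP exactly when the
two maxima agree at the initial state. -/

namespace MDP

/-! ### Finite-horizon hitting probabilities -/

variable {S A : Type*} [Fintype S]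

/-- The transition probability from `s` to `s'` at time `t` under the policy `π`. -/
noncomputable def trans (M : MDP S A) (π : M.policies) (t : ℕ) (s s' : S) : ℝ :=
  ∑ a ∈ M.act s, π.1 t s a * M.P s a s'

lemma trans_nonneg (M : MDP S A) (π : M.policies) (t : ℕ) (s s' : S) :
    0 ≤ M.trans π t s s' :=
  Finset.sum_nonneg fun a _ => mul_nonneg ((π.2 t s).1 a) (M.P_nonneg s a s')

lemma trans_mul_sum (M : MDP S A) (π : M.policies) (t : ℕ) (s : S) (z : S → ℝ) :
    ∑ s', M.trans π t s s' * z s' =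
      ∑ a ∈ M.act s, π.1 t s a * ∑ s', M.P s a s' * z s' := by
  simp_rw [trans, Finset.sum_mul, Finset.mul_sum]
  rw [Finset.sum_comm]
  simp_rw [mul_assoc]

/-- The states of `B` are absorbing in `M`. -/
def Absorbing (M : MDP S A) (B : Set S) : Prop := ∀ s ∈ B, ∀ a ∈ M.act s, M.P s a s = 1

lemma Absorbing.P_eq_zero {M : MDP S A} {B : Set S} (hB : M.Absorbing B) {s : S} (hs : s ∈ B)
    {a : A} (ha : a ∈ M.act s) {s' : S} (h : s' ≠ s) : M.P s a s' = 0 := by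
  classical
  have h1 := M.P_sum s a ha
  rw [← Finset.add_sum_erase _ _ (Finset.mem_univ s), hB s hs a ha, add_eq_left,
    Finset.sum_eq_zero_iff_of_nonneg fun u _ => M.P_nonneg s a u] at h1
  exact h1 s' (by simp [h])

lemma Absorbing.sum_P_mul {M : MDP S A} {B : Set S} (hB : M.Absorbing B) {s : S} (hs : s ∈ B)
    {a : A} (ha : a ∈ M.act s) (z : S → ℝ) : ∑ s', M.P s a s' * z s' = z s := by
  rw [Finset.sum_eq_single s (fun u _ hu => by rw [hB.P_eq_zero hs ha hu, zero_mul]) (by simp),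
    hB s hs a ha, one_mul]

lemma Absorbing.sum_trans_mul {M : MDP S A} {B : Set S} (hB : M.Absorbing B) (π : M.policies)
    (t : ℕ) {s : S} (hs : s ∈ B) (z : S → ℝ) : ∑ s', M.trans π t s s' * z s' = z s := by
  rw [trans_mul_sum, Finset.sum_congr rfl fun a ha => by rw [hB.sum_P_mul hs ha], ← Finset.sum_mul,
    (π.2 t s).2.2, one_mul]

/-- The probability of being in `B` after `n` more steps, as a function of the state at time `t`. -/
noncomputable def hitVec (M : MDP S A) (B : Set S) (π : M.policies) : ℕ → ℕ → S → ℝ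
  | _, 0 => B.indicator 1
  | t, n + 1 => fun s => ∑ s', M.trans π t s s' * hitVec M B π (t + 1) n s'

lemma hitVec_succ (M : MDP S A) (B : Set S) (π : M.policies) (t n : ℕ) (s : S) :
    M.hitVec B π t (n + 1) s = ∑ s', M.trans π t s s' * M.hitVec B π (t + 1) n s' := rfl

lemma Absorbing.hitVec_of_mem {M : MDP S A} {B : Set S} (hB : M.Absorbing B) (π : M.policies)
    (t n : ℕ) {s : S} (hs : s ∈ B) : M.hitVec B π t n s = 1 := by
  induction n generalizing t with
  | zero => simp [hitVec, hs]
  | succ n ih => rw [hitVec_succ, hB.sum_trans_mul π t hs, ih]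

lemma hitVec_nonneg (M : MDP S A) (B : Set S) (π : M.policies) (t n : ℕ) (s : S) :
    0 ≤ M.hitVec B π t n s := by
  induction n generalizing t s with
  | zero => exact Set.indicator_nonneg (fun _ _ => zero_le_one) s
  | succ n ih => exact Finset.sum_nonneg fun s' _ => mul_nonneg (M.trans_nonneg π t s s') (ih _ _)

/-! ### Reach probabilities as limits of finite-horizon ones -/

variable [MeasurableSpace S] [DiscreteMeasurableSpace S]

instance (M : MDP S A) (π : M.policies) (s : S) : IsProbabilityMeasure (M.pathMeasure π s) := by
  unfold pathMeasure
  infer_instance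

/-- The probability of being in the state `s'` at time `t`. -/
noncomputable def occupation (M : MDP S A) (π : M.policies) (s : S) (t : ℕ) (s' : S) : ℝ :=
  (M.pathMeasure π s).real {ω | ω t = s'}

lemma pathMeasure_map_zero (M : MDP S A) (π : M.policies) (s : S) :
    (M.pathMeasure π s).map (fun ω => ω 0) = Measure.dirac s := by
  have h : (fun ω : ℕ → S => ω 0) =
      (fun h : (_ : Finset.Iic 0) → S => h ⟨0, Finset.mem_Iic.2 le_rfl⟩) ∘
        Preorder.frestrictLe (π := fun _ => S) 0 := rfl
  rw [h, ← Measure.map_map (by fun_prop) (by fun_prop), pathMeasure, Kernel.trajMeasure,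
    Measure.map_comp _ _ (by fun_prop), Kernel.traj_map_frestrictLe, Kernel.partialTraj_self,
    Measure.id_comp, Measure.map_map (by fun_prop) (by fun_prop)]
  exact Measure.map_id

lemma occupation_zero [DecidableEq S] (M : MDP S A) (π : M.policies) (s s' : S) :
    M.occupation π s 0 s' = if s = s' then 1 else 0 := by
  have h := congrArg (fun μ => μ.real {s'}) (M.pathMeasure_map_zero π s)
  rw [map_measureReal_apply (by fun_prop) (measurableSet_singleton _)] at h
  refine Eq.trans h ?_
  rw [measureReal_def, Measure.dirac_apply' _ (measurableSet_singleton _)]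
  by_cases hs : s = s' <;> simp [hs]

/-- The joint law of the history up to `t` and the next state is the composition product of the
history's law with `stepKernel`. On `ω t = u` the kernel is constant, so its integral is a product.
-/
lemma pathMeasure_real_pair (M : MDP S A) (π : M.policies) (s : S) (t : ℕ) (u v : S) :
    (M.pathMeasure π s).real {ω | ω t = u ∧ ω (t + 1) = v} =
      M.occupation π s t u * M.trans π t u v := by
  have key := Kernel.map_frestrictLe_trajMeasure_compProd_eq_map_trajMeasure
    (X := fun _ => S) (μ₀ := Measure.dirac s) (κ := M.stepKernel π) (a := t)
  change (M.pathMeasure π s).map _ ⊗ₘ _ = (M.pathMeasure π s).map _ at key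
  let U : Set ((_ : Finset.Iic t) → S) := {h | h ⟨t, Finset.mem_Iic.2 le_rfl⟩ = u}
  have hU : MeasurableSet U :=
    measurableSet_eq_fun (measurable_pi_apply _) measurable_const
  have h := congrArg (fun μ => μ (U ×ˢ {v})) key
  rw [Measure.compProd_apply_prod hU (measurableSet_singleton v),
    Measure.map_apply (by fun_prop) (hU.prod (measurableSet_singleton v)),
    setLIntegral_congr_fun (g := fun _ => M.step π t u v) hU, setLIntegral_const,
    Measure.map_apply (by fun_prop) hU] at h
  · have h2 := congrArg ENNReal.toReal h
    rw [ENNReal.toReal_mul] at h2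
    refine (Eq.trans ?_ h2.symm).trans ?_
    · rfl
    · rw [mul_comm]
      congr 1
      rw [step, PMF.ofFintype_apply]
      exact ENNReal.toReal_ofReal (M.trans_nonneg π t u v)
  · intro x hx
    have hx' : x ⟨t, Finset.mem_Iic.2 le_rfl⟩ = u := hx
    simp only [stepKernel, Kernel.comap_apply, hx']
    exact PMF.toMeasure_apply_singleton _ _ (measurableSet_singleton v)

lemma occupation_succ (M : MDP S A) (π : M.policies) (s : S) (t : ℕ) (v : S) :
    M.occupation π s (t + 1) v = ∑ u, M.occupation π s t u * M.trans π t u v := by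
  simp_rw [← pathMeasure_real_pair]
  rw [← measureReal_biUnion_finset]
  · unfold occupation
    congr 1
    ext ω
    simp
  · intro u _ w _ huw
    refine Set.disjoint_left.2 fun ω h1 h2 => huw (h1.1.symm.trans h2.1)
  · intro u _
    measurability

/-- The forward recursion of `occupation` is dual to the backward recursion of `hitVec`, so a step
can be moved from one factor to the other. At `t = 0` the occupation is a point mass, which isolates
`hitVec`. -/
lemma sum_occupation_mul_hitVec (M : MDP S A) (B : Set S) (π : M.policies) (s : S) (n t : ℕ) :
    ∑ u, M.occupation π s t u * M.hitVec B π t n u =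
      ∑ u, M.occupation π s (t + n) u * B.indicator 1 u := by
  induction n generalizing t with
  | zero => rfl
  | succ n ih =>
    have h : t + (n + 1) = t + 1 + n := by omega
    rw [h, ← ih (t + 1)]
    simp_rw [occupation_succ, hitVec, Finset.mul_sum, Finset.sum_mul]
    rw [Finset.sum_comm]
    simp_rw [mul_assoc]

lemma pathMeasure_real_mem (M : MDP S A) (B : Set S) (π : M.policies) (s : S) (n : ℕ) :
    (M.pathMeasure π s).real {ω | ω n ∈ B} = M.hitVec B π 0 n s := by
  classical
  have h := M.sum_occupation_mul_hitVec B π s n 0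
  simp_rw [occupation_zero, zero_add] at h
  simp only [ite_mul, one_mul, zero_mul, Finset.sum_ite_eq, Finset.mem_univ, if_true] at h
  rw [h]
  have h2 : {ω : ℕ → S | ω n ∈ B} =
      ⋃ u ∈ Finset.univ.filter (· ∈ B), {ω : ℕ → S | ω n = u} := by
    ext ω
    simp
  rw [h2, measureReal_biUnion_finset, Finset.sum_filter]
  · refine Finset.sum_congr rfl fun u _ => ?_
    by_cases hu : u ∈ B <;> simp [hu, occupation]
  · intro u _ w _ huw
    exact Set.disjoint_left.2 fun ω h1 h2 => huw (h1.symm.trans h2)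
  · intro u _
    measurability

lemma Absorbing.ae_mem_succ {M : MDP S A} {B : Set S} (hB : M.Absorbing B) (π : M.policies)
    (s : S) : ∀ᵐ ω ∂M.pathMeasure π s, ∀ t, ω t ∈ B → ω (t + 1) ∈ B := by
  rw [ae_all_iff]
  intro t
  have h : ∀ u v : S, u ∈ B → v ∉ B →
      ∀ᵐ ω ∂M.pathMeasure π s, ¬ (ω t = u ∧ ω (t + 1) = v) := by
    intro u v hu hv
    have h0 : M.trans π t u v = 0 := Finset.sum_eq_zero fun a ha => by
      rw [hB.P_eq_zero hu ha fun h : v = u => hv (h ▸ hu), mul_zero]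
    have h1 := M.pathMeasure_real_pair π s t u v
    rw [h0, mul_zero, measureReal_eq_zero_iff] at h1
    rw [ae_iff]
    simpa using h1
  have h' : ∀ᵐ ω ∂M.pathMeasure π s, ∀ u v : S, u ∈ B → v ∉ B →
      ¬ (ω t = u ∧ ω (t + 1) = v) := by
    simp_rw [ae_all_iff]
    exact h
  filter_upwards [h'] with ω hω h1
  by_contra h2
  exact hω _ _ h1 h2 ⟨rfl, rfl⟩

/-- Continuity of the measure from below along the events of hitting `B` by time `n`; absorption
identifies these, up to null sets, with `ω n ∈ B`. -/
lemma Absorbing.tendsto_hitVec {M : MDP S A} {B : Set S} (hB : M.Absorbing B) (π : M.policies)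
    (s : S) :
    Filter.Tendsto (fun n => M.hitVec B π 0 n s) Filter.atTop (nhds (M.reachProb B π s)) := by
  have hset : {ω : ℕ → S | ∃ t, ω t ∈ B} = ⋃ n, {ω | ∃ t ≤ n, ω t ∈ B} := by
    ext ω
    simp only [Set.mem_ofPred_eq, Set.mem_iUnion]
    exact ⟨fun ⟨t, h⟩ => ⟨t, t, le_rfl, h⟩, fun ⟨_, t, _, h⟩ => ⟨t, h⟩⟩
  have hmono : Monotone fun n : ℕ => {ω : ℕ → S | ∃ t ≤ n, ω t ∈ B} :=
    fun m n hmn ω ⟨t, ht, h⟩ => ⟨t, ht.trans hmn, h⟩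
  have hlim := tendsto_measure_iUnion_atTop (μ := M.pathMeasure π s) hmono
  rw [← hset] at hlim
  have hlim' := (ENNReal.tendsto_toReal (measure_ne_top _ _)).comp hlim
  refine hlim'.congr fun n => ?_
  rw [← pathMeasure_real_mem]
  refine congrArg ENNReal.toReal (measure_congr ?_)
  filter_upwards [hB.ae_mem_succ π s] with ω hω
  refine propext ⟨?_, fun h => ⟨n, le_rfl, h⟩⟩
  rintro ⟨t, ht, h⟩
  exact Nat.le_induction (P := fun n _ => ω n ∈ B) h (fun k _ hk => hω k hk) n ht

end MDP

/-! ### Value iteration, with and without discount -/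

namespace MDP

variable {S A : Type*} [Fintype S]

lemma sum_P_mul_mono (M : MDP S A) (s : S) (a : A) {z w : S → ℝ} (h : ∀ s, z s ≤ w s) :
    ∑ s', M.P s a s' * z s' ≤ ∑ s', M.P s a s' * w s' :=
  Finset.sum_le_sum fun s' _ => mul_le_mul_of_nonneg_left (h s') (M.P_nonneg s a s')

lemma sum_P_mul_nonneg (M : MDP S A) (s : S) (a : A) {z : S → ℝ} (h : ∀ s, 0 ≤ z s) :
    0 ≤ ∑ s', M.P s a s' * z s' :=
  Finset.sum_nonneg fun s' _ => mul_nonneg (M.P_nonneg s a s') (h s')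

lemma sum_P_mul_le_one (M : MDP S A) {s : S} {a : A} (ha : a ∈ M.act s) {z : S → ℝ}
    (h : ∀ s, z s ≤ 1) : ∑ s', M.P s a s' * z s' ≤ 1 :=
  (M.sum_P_mul_mono s a (w := 1) h).trans (by simp [M.P_sum s a ha])

/-- The greatest expected value of `z` after one step from `s`. -/
noncomputable def bestStep (M : MDP S A) (z : S → ℝ) (s : S) : ℝ :=
  ⨆ a : M.act s, ∑ s', M.P s a s' * z s'

lemma le_bestStep (M : MDP S A) (z : S → ℝ) {s : S} {a : A} (ha : a ∈ M.act s) :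
    ∑ s', M.P s a s' * z s' ≤ M.bestStep z s :=
  le_ciSup (f := fun a : M.act s => ∑ s', M.P s a s' * z s') (Set.finite_range _).bddAbove ⟨a, ha⟩

lemma exists_eq_bestStep (M : MDP S A) (z : S → ℝ) {s : S} (hs : (M.act s).Nonempty) :
    ∃ a ∈ M.act s, ∑ s', M.P s a s' * z s' = M.bestStep z s := by
  have : Nonempty (M.act s) := hs.to_subtype
  obtain ⟨a, ha⟩ := exists_eq_ciSup_of_finite
    (f := fun a : M.act s => ∑ s', M.P s a s' * z s')
  exact ⟨a, a.2, ha⟩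

open Classical in
/-- The dynamic programming operator of the probability of reaching `B`, where each step is
discounted by the factor `l`. -/
noncomputable def reachOp (M : MDP S A) (B : Set S) (l : ℝ) (z : S → ℝ) (s : S) : ℝ :=
  if s ∈ B then 1 else l * M.bestStep z s

lemma reachOp_of_mem (M : MDP S A) {B : Set S} (l : ℝ) (z : S → ℝ) {s : S} (hs : s ∈ B) :
    M.reachOp B l z s = 1 := if_pos hs

lemma reachOp_of_notMem (M : MDP S A) {B : Set S} (l : ℝ) (z : S → ℝ) {s : S} (hs : s ∉ B) :
    M.reachOp B l z s = l * M.bestStep z s := if_neg hs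

/-- Value iteration for the discounted probability of reaching `B`. -/
noncomputable def reachIter (M : MDP S A) (B : Set S) (l : ℝ) : ℕ → S → ℝ
  | 0 => B.indicator 1
  | n + 1 => M.reachOp B l (reachIter M B l n)

/-- The limit of value iteration. -/
noncomputable def reachLim (M : MDP S A) (B : Set S) (l : ℝ) (s : S) : ℝ :=
  ⨆ n, M.reachIter B l n s

lemma bestStep_mono {M : MDP S A} (hact : ∀ s, (M.act s).Nonempty) {z w : S → ℝ}
    (h : ∀ s, z s ≤ w s) (s : S) : M.bestStep z s ≤ M.bestStep w s := by
  obtain ⟨a, ha, he⟩ := M.exists_eq_bestStep z (hact s)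
  rw [← he]
  exact (M.sum_P_mul_mono s a h).trans (M.le_bestStep w ha)

lemma reachIter_of_mem (M : MDP S A) {B : Set S} (l : ℝ) (n : ℕ) {s : S} (hs : s ∈ B) :
    M.reachIter B l n s = 1 := by
  cases n with
  | zero => simp [reachIter, hs]
  | succ n => exact M.reachOp_of_mem l _ hs

lemma reachIter_mem_Icc {M : MDP S A} (hact : ∀ s, (M.act s).Nonempty) (B : Set S) {l : ℝ}
    (hl : l ∈ Set.Icc (0 : ℝ) 1) (n : ℕ) (s : S) : M.reachIter B l n s ∈ Set.Icc (0 : ℝ) 1 := by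
  induction n generalizing s with
  | zero => by_cases hs : s ∈ B <;> simp [reachIter, hs]
  | succ n ih =>
    by_cases hs : s ∈ B
    · simp [M.reachIter_of_mem l _ hs]
    · rw [reachIter, M.reachOp_of_notMem _ _ hs]
      obtain ⟨a, ha, he⟩ := M.exists_eq_bestStep (M.reachIter B l n) (hact s)
      rw [← he]
      have h0 := M.sum_P_mul_nonneg s a fun s => (ih s).1
      exact ⟨mul_nonneg hl.1 h0, mul_le_one₀ hl.2 h0 (M.sum_P_mul_le_one ha fun s => (ih s).2)⟩

lemma reachIter_le_succ {M : MDP S A} (hact : ∀ s, (M.act s).Nonempty) (B : Set S) {l : ℝ}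
    (hl : l ∈ Set.Icc (0 : ℝ) 1) (n : ℕ) (s : S) :
    M.reachIter B l n s ≤ M.reachIter B l (n + 1) s := by
  induction n generalizing s with
  | zero =>
    by_cases hs : s ∈ B
    · rw [M.reachIter_of_mem l _ hs, M.reachIter_of_mem l _ hs]
    · have := (reachIter_mem_Icc hact B hl 1 s).1
      simpa [reachIter, hs] using this
  | succ n ih =>
    by_cases hs : s ∈ B
    · rw [M.reachIter_of_mem l _ hs, M.reachIter_of_mem l _ hs]
    · rw [reachIter, M.reachOp_of_notMem _ _ hs, reachIter, M.reachOp_of_notMem _ _ hs]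
      exact mul_le_mul_of_nonneg_left (bestStep_mono hact ih s) hl.1

lemma tendsto_reachIter {M : MDP S A} (hact : ∀ s, (M.act s).Nonempty) (B : Set S) {l : ℝ}
    (hl : l ∈ Set.Icc (0 : ℝ) 1) (s : S) :
    Filter.Tendsto (fun n => M.reachIter B l n s) Filter.atTop (nhds (M.reachLim B l s)) :=
  tendsto_atTop_ciSup (monotone_nat_of_le_succ fun n => reachIter_le_succ hact B hl n s)
    ⟨1, by rintro _ ⟨n, rfl⟩; exact (reachIter_mem_Icc hact B hl n s).2⟩

lemma reachIter_le_reachLim {M : MDP S A} (hact : ∀ s, (M.act s).Nonempty) (B : Set S) {l : ℝ}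
    (hl : l ∈ Set.Icc (0 : ℝ) 1) (n : ℕ) (s : S) : M.reachIter B l n s ≤ M.reachLim B l s :=
  (monotone_nat_of_le_succ fun n => reachIter_le_succ hact B hl n s).ge_of_tendsto
    (tendsto_reachIter hact B hl s) n

lemma reachLim_mem_Icc {M : MDP S A} (hact : ∀ s, (M.act s).Nonempty) (B : Set S) {l : ℝ}
    (hl : l ∈ Set.Icc (0 : ℝ) 1) (s : S) : M.reachLim B l s ∈ Set.Icc (0 : ℝ) 1 :=
  isClosed_Icc.mem_of_tendsto (tendsto_reachIter hact B hl s)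
    (Filter.Eventually.of_forall fun n => reachIter_mem_Icc hact B hl n s)

lemma reachLim_of_mem (M : MDP S A) {B : Set S} (l : ℝ) {s : S} (hs : s ∈ B) :
    M.reachLim B l s = 1 := by
  simp [reachLim, M.reachIter_of_mem l _ hs]

/-- Monotone iterates give `≤`. For `≥`, an action that is best for the limit is held fixed, so that
only a finite sum has to pass to the limit. -/
lemma reachLim_of_notMem {M : MDP S A} (hact : ∀ s, (M.act s).Nonempty) {B : Set S} {l : ℝ}
    (hl : l ∈ Set.Icc (0 : ℝ) 1) {s : S} (hs : s ∉ B) :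
    M.reachLim B l s = l * M.bestStep (M.reachLim B l) s := by
  have hsucc := (Filter.tendsto_add_atTop_iff_nat 1).2 (tendsto_reachIter hact B hl s)
  simp only [reachIter, M.reachOp_of_notMem _ _ hs] at hsucc
  apply le_antisymm
  · exact le_of_tendsto hsucc (Filter.Eventually.of_forall fun n =>
      mul_le_mul_of_nonneg_left (bestStep_mono hact (reachIter_le_reachLim hact B hl n) s) hl.1)
  · obtain ⟨a, ha, he⟩ := M.exists_eq_bestStep (M.reachLim B l) (hact s)
    rw [← he]
    have h : Filter.Tendsto (fun n => l * ∑ s', M.P s a s' * M.reachIter B l n s') Filter.atTop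
        (nhds (l * ∑ s', M.P s a s' * M.reachLim B l s')) :=
      (tendsto_finsetSum _ fun s' _ => (tendsto_reachIter hact B hl s').const_mul _).const_mul _
    exact le_of_tendsto_of_tendsto' h hsucc fun n =>
      mul_le_mul_of_nonneg_left (M.le_bestStep _ ha) hl.1

/-- Within `n` steps the discount is applied at most `n` times. For fixed `n` the loss disappears as
`l → 1`. -/
lemma pow_mul_reachIter_le {M : MDP S A} (hact : ∀ s, (M.act s).Nonempty) (B : Set S) {l : ℝ}
    (hl : l ∈ Set.Icc (0 : ℝ) 1) (n : ℕ) (s : S) :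
    l ^ n * M.reachIter B 1 n s ≤ M.reachIter B l n s := by
  induction n generalizing s with
  | zero => simp [reachIter]
  | succ n ih =>
    by_cases hs : s ∈ B
    · rw [M.reachIter_of_mem _ _ hs, M.reachIter_of_mem _ _ hs, mul_one]
      exact pow_le_one₀ hl.1 hl.2
    · rw [reachIter, M.reachOp_of_notMem _ _ hs, reachIter, M.reachOp_of_notMem _ _ hs, one_mul,
        pow_succ', mul_assoc]
      refine mul_le_mul_of_nonneg_left ?_ hl.1
      obtain ⟨a, ha, he⟩ := M.exists_eq_bestStep (M.reachIter B 1 n) (hact s)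
      refine le_trans ?_ (M.le_bestStep _ ha)
      rw [← he, Finset.mul_sum]
      refine Finset.sum_le_sum fun s' _ => ?_
      rw [mul_left_comm]
      exact mul_le_mul_of_nonneg_left (ih s') (M.P_nonneg s a s')

/-- Every iterate stays below `z` by induction. On `Z` no supersolution inequality is available;
there the vanishing of the limit replaces it. -/
lemma reachLim_le {M : MDP S A} (hact : ∀ s, (M.act s).Nonempty) {B Z : Set S}
    (hZ : ∀ s ∈ Z, M.reachLim B 1 s = 0) {z : S → ℝ} (h0 : ∀ s, 0 ≤ z s) (h1 : ∀ s ∈ B, z s = 1)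
    (hz : ∀ s ∉ B ∪ Z, M.bestStep z s ≤ z s) (s : S) : M.reachLim B 1 s ≤ z s := by
  have hl : (1 : ℝ) ∈ Set.Icc (0 : ℝ) 1 := by simp
  refine le_of_tendsto (tendsto_reachIter hact B hl s) (Filter.Eventually.of_forall fun n => ?_)
  induction n generalizing s with
  | zero => by_cases hs : s ∈ B <;> simp [reachIter, hs, h0, h1]
  | succ n ih =>
    by_cases hs : s ∈ B
    · rw [M.reachIter_of_mem _ _ hs, h1 s hs]
    by_cases hs' : s ∈ Z
    · exact (reachIter_le_reachLim hact B hl _ s).trans ((hZ s hs').trans_le (h0 s))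
    rw [reachIter, M.reachOp_of_notMem _ _ hs, one_mul]
    exact (bestStep_mono hact ih s).trans (hz s (by simp [hs, hs']))

/-- The stationary policy that always takes the action `d s` in the state `s`. -/
noncomputable def stationary (M : MDP S A) (d : S → A) (hd : ∀ s, d s ∈ M.act s) : M.policies :=
  open Classical in
  ⟨fun _ s a => if a = d s then 1 else 0, fun t s => ⟨fun a => by dsimp only; split_ifs <;> norm_num,
    fun a ha => if_neg fun h : a = d s => ha (h ▸ hd s), by
      rw [Finset.sum_eq_single_of_mem (d s) (hd s) fun a _ ha => if_neg ha, if_pos rfl]⟩⟩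

lemma stationary_trans (M : MDP S A) (d : S → A) (hd : ∀ s, d s ∈ M.act s) (t : ℕ) (s s' : S) :
    M.trans (M.stationary d hd) t s s' = M.P s (d s) s' := by
  rw [trans, Finset.sum_eq_single_of_mem (d s) (hd s)]
  · simp [stationary]
  · intro a _ ha
    simp [stationary, ha]

/-- A randomized rule averages over actions, and an average is at most the maximum, whatever the
time `t`. -/
lemma Absorbing.hitVec_le_reachIter {M : MDP S A} {B : Set S} (hB : M.Absorbing B)
    (π : M.policies) (t n : ℕ) (s : S) :
    M.hitVec B π t n s ≤ M.reachIter B 1 n s := by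
  induction n generalizing t s with
  | zero => rfl
  | succ n ih =>
    by_cases hs : s ∈ B
    · rw [hB.hitVec_of_mem π _ _ hs, M.reachIter_of_mem _ _ hs]
    rw [reachIter, M.reachOp_of_notMem _ _ hs, one_mul, hitVec_succ, trans_mul_sum]
    calc _ ≤ ∑ a ∈ M.act s, π.1 t s a * M.bestStep (M.reachIter B 1 n) s :=
          Finset.sum_le_sum fun a ha => mul_le_mul_of_nonneg_left
            ((M.sum_P_mul_mono s a (ih (t + 1))).trans (M.le_bestStep _ ha)) ((π.2 t s).1 a)
      _ = _ := by rw [← Finset.sum_mul, (π.2 t s).2.2, one_mul]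

/-! ### Optimal stationary policies and the least solution -/

variable [MeasurableSpace S] [DiscreteMeasurableSpace S]

lemma Absorbing.reachProb_le_reachLim {M : MDP S A} (hact : ∀ s, (M.act s).Nonempty) {B : Set S}
    (hB : M.Absorbing B) (π : M.policies) (s : S) :
    M.reachProb B π s ≤ M.reachLim B 1 s :=
  le_of_tendsto_of_tendsto' (hB.tendsto_hitVec π s) (tendsto_reachIter hact B (by simp) s)
    fun n => hB.hitVec_le_reachIter π 0 n s

/-- A stationary policy that is greedy for the discounted problem reaches `B` at least with the
discounted probability. -/
lemma Absorbing.reachLim_le_reachProb_of_greedy {M : MDP S A} (hact : ∀ s, (M.act s).Nonempty)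
    {B : Set S} (hB : M.Absorbing B) {l : ℝ} (hl : l ∈ Set.Ico (0 : ℝ) 1) {d : S → A}
    (hd : ∀ s, d s ∈ M.act s)
    (hg : ∀ s, ∑ s', M.P s (d s) s' * M.reachLim B l s' = M.bestStep (M.reachLim B l) s) (s : S) :
    M.reachLim B l s ≤ M.reachProb B (M.stationary d hd) s := by
  have hl' : l ∈ Set.Icc (0 : ℝ) 1 := ⟨hl.1, hl.2.le⟩
  -- After `n` greedy steps the remaining value is at most 1 and carries weight at most `l ^ n`,
  -- which vanishes only because `l < 1`. The time `t` is general since each step of the recursion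
  -- shifts it.
  have key : ∀ n t s, M.reachLim B l s ≤ M.hitVec B (M.stationary d hd) t n s + l ^ n := by
    intro n
    induction n with
    | zero =>
      intro t s
      rw [pow_zero]
      exact (reachLim_mem_Icc hact B hl' s).2.trans (le_add_of_nonneg_left (hitVec_nonneg ..))
    | succ n ih =>
      intro t s
      by_cases hs : s ∈ B
      · rw [M.reachLim_of_mem l hs, hB.hitVec_of_mem _ _ _ hs]
        exact le_add_of_nonneg_right (pow_nonneg hl.1 _)
      · rw [reachLim_of_notMem hact hl' hs, ← hg, hitVec_succ]
        simp_rw [stationary_trans]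
        have h1 := M.sum_P_mul_mono s (d s) (ih (t + 1))
        simp_rw [mul_add] at h1
        rw [Finset.sum_add_distrib, ← Finset.sum_mul, M.P_sum s _ (hd s), one_mul] at h1
        have h2 := M.sum_P_mul_nonneg s (d s) (M.hitVec_nonneg B (M.stationary d hd) (t + 1) n)
        have h3 := mul_le_mul_of_nonneg_left h1 hl.1
        have h4 := mul_le_of_le_one_left h2 hl.2.le
        rw [pow_succ']
        linarith
  have h := (hB.tendsto_hitVec (M.stationary d hd) s).add
    (tendsto_pow_atTop_nhds_zero_of_lt_one hl.1 hl.2)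
  rw [add_zero] at h
  exact ge_of_tendsto' h fun n => key n 0 s

/-- Some stationary deterministic policy maximizes the probability of reaching `B` from every
state. -/
lemma Absorbing.exists_stationary [Finite A] {M : MDP S A} (hact : ∀ s, (M.act s).Nonempty)
    {B : Set S} (hB : M.Absorbing B) :
    ∃ (d : S → A) (hd : ∀ s, d s ∈ M.act s),
      ∀ s, M.reachProb B (M.stationary d hd) s = M.reachLim B 1 s := by
  let l : ℕ → ℝ := fun k => 1 - 1 / ((k : ℝ) + 1)
  have hl : ∀ k, l k ∈ Set.Ico (0 : ℝ) 1 := by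
    intro k
    have h1 : (0 : ℝ) < 1 / ((k : ℝ) + 1) := by positivity
    have h2 : 1 / ((k : ℝ) + 1) ≤ 1 := by
      rw [div_le_one (by positivity)]
      linarith [(Nat.cast_nonneg k : (0 : ℝ) ≤ k)]
    exact ⟨by simp only [l]; linarith, by simp only [l]; linarith⟩
  have hl1 : Filter.Tendsto l Filter.atTop (nhds 1) := by
    simpa [l] using tendsto_one_div_add_atTop_nhds_zero_nat.const_sub (1 : ℝ)
  choose d hd hg using fun (k : ℕ) (s : S) =>
    M.exists_eq_bestStep (M.reachLim B (l k)) (hact s)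
  -- Pigeonhole on the finite set of rules `S → A`: one rule is greedy for infinitely many of the
  -- discounts `l k → 1`.
  obtain ⟨e, he⟩ := Finite.exists_infinite_fiber d
  have hfreq : ∃ᶠ k in Filter.atTop, d k = e :=
    Nat.frequently_atTop_iff_infinite.2 (Set.infinite_coe_iff.1 he)
  obtain ⟨k₀, hk₀⟩ := hfreq.exists
  refine ⟨e, hk₀ ▸ hd k₀, fun s => le_antisymm (hB.reachProb_le_reachLim hact _ s) ?_⟩
  -- The horizon `n` is fixed before `l` tends to 1, so no interchange of limits is needed.
  refine le_of_tendsto' (tendsto_reachIter hact B (by simp) s) fun n => ?_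
  have h := (hl1.pow n).mul_const (M.reachIter B 1 n s)
  rw [one_pow, one_mul] at h
  refine le_of_tendsto_of_frequently h (hfreq.mono ?_)
  rintro k rfl
  have hk : l k ∈ Set.Icc (0 : ℝ) 1 := ⟨(hl k).1, (hl k).2.le⟩
  exact (pow_mul_reachIter_le hact B hk n s).trans <| (reachIter_le_reachLim hact B hk n s).trans <|
    hB.reachLim_le_reachProb_of_greedy hact (hl k) (hd k) (hg k) s

lemma Absorbing.maxReach_eq [Finite A] {M : MDP S A} (hact : ∀ s, (M.act s).Nonempty)
    {B : Set S} (hB : M.Absorbing B) : M.maxReach B = M.reachLim B 1 := by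
  obtain ⟨d, hd, h⟩ := hB.exists_stationary hact
  funext s
  have : Nonempty M.policies := ⟨M.stationary d hd⟩
  refine le_antisymm (ciSup_le fun π => hB.reachProb_le_reachLim hact π s) ?_
  rw [← h]
  exact le_ciSup (f := fun π : M.policies => M.reachProb B π s)
    ⟨M.reachLim B 1 s, by rintro _ ⟨π, rfl⟩; exact hB.reachProb_le_reachLim hact π s⟩ _

lemma Absorbing.reachProb_le_maxReach [Finite A] {M : MDP S A} (hact : ∀ s, (M.act s).Nonempty)
    {B : Set S} (hB : M.Absorbing B) (π : M.policies) (s : S) :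
    M.reachProb B π s ≤ M.maxReach B s := by
  rw [hB.maxReach_eq hact]
  exact hB.reachProb_le_reachLim hact π s

/-- Off `B` this is the limit equation; on `B` absorption makes every action return the current
value. -/
lemma Absorbing.maxReach_eq_bestStep [Finite A] {M : MDP S A} (hact : ∀ s, (M.act s).Nonempty)
    {B : Set S} (hB : M.Absorbing B) (s : S) :
    M.maxReach B s = M.bestStep (M.maxReach B) s := by
  rw [hB.maxReach_eq hact]
  by_cases hs : s ∈ B
  · obtain ⟨a, ha, he⟩ := M.exists_eq_bestStep (M.reachLim B 1) (hact s)
    rw [← he, hB.sum_P_mul hs ha]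
  · simpa using reachLim_of_notMem hact (l := 1) (by simp) hs

/-- The maximal probability of reaching `B` is the least nonnegative solution of the optimality
equations, when these prescribe the value zero on a set `Z` where the maximum vanishes. -/
lemma Absorbing.isLeast_maxReach [Finite A] {M : MDP S A} (hact : ∀ s, (M.act s).Nonempty)
    {B Z : Set S} (hB : M.Absorbing B) (hZ : ∀ s ∈ Z, M.maxReach B s = 0) :
    IsLeast {z : S → ℝ | (∀ s, 0 ≤ z s) ∧ (∀ s ∈ B, z s = 1) ∧ (∀ s ∈ Z, z s = 0) ∧
      ∀ s, s ∉ B ∪ Z → IsGreatest ((fun a => ∑ s', M.P s a s' * z s') '' M.act s) (z s)}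
      (M.maxReach B) := by
  constructor
  · refine ⟨fun s => ?_, fun s hs => ?_, hZ, fun s _ => ?_⟩
    · rw [hB.maxReach_eq hact]
      exact (reachLim_mem_Icc hact B (by simp) s).1
    · rw [hB.maxReach_eq hact, M.reachLim_of_mem 1 hs]
    · rw [hB.maxReach_eq_bestStep hact]
      refine ⟨M.exists_eq_bestStep _ (hact s), ?_⟩
      rintro _ ⟨a, ha, rfl⟩
      exact M.le_bestStep _ ha
  · rintro z ⟨h0, h1, -, hz⟩ s
    rw [hB.maxReach_eq hact] at hZ ⊢
    refine reachLim_le hact hZ h0 h1 (fun s hs => ?_) s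
    obtain ⟨a, ha, he⟩ := M.exists_eq_bestStep z (hact s)
    rw [← he]
    exact (hz s hs).2 ⟨a, ha, rfl⟩

end MDP

/-! ### Effect of removing actions -/

namespace MDP

variable {S A : Type*} [Fintype S]

lemma mem_remove_act (M : MDP S A) (R : S → A → Prop) (s : S) (a : A) :
    a ∈ (M.remove R).act s ↔ a ∈ M.act s ∧ ¬ R s a := by
  simp [remove]

lemma policies_subset_of_act_subset {M N : MDP S A} (h : ∀ s, N.act s ⊆ M.act s) :
    N.policies ⊆ M.policies := fun d hd t s =>
  ⟨(hd t s).1, fun a ha => (hd t s).2.1 a fun h' => ha (h s h'), by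
    rw [← (hd t s).2.2]
    exact (Finset.sum_subset (h s) fun a _ ha => (hd t s).2.1 a ha).symm⟩

lemma Absorbing.of_act_subset {M N : MDP S A} {B : Set S} (hB : M.Absorbing B)
    (hact : ∀ s, N.act s ⊆ M.act s) (hP : N.P = M.P) : N.Absorbing B :=
  fun s hs a ha => by rw [hP]; exact hB s hs a (hact s ha)

lemma hitVec_congr {M N : MDP S A} (hact : ∀ s, N.act s ⊆ M.act s) (hP : N.P = M.P) (B : Set S)
    {π : ℕ → S → A → ℝ} (hN : π ∈ N.policies) (hM : π ∈ M.policies) (t n : ℕ) :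
    N.hitVec B ⟨π, hN⟩ t n = M.hitVec B ⟨π, hM⟩ t n := by
  have htrans : ∀ t s s', N.trans ⟨π, hN⟩ t s s' = M.trans ⟨π, hM⟩ t s s' := fun t s s' => by
    simp only [trans, hP]
    exact Finset.sum_subset (hact s) fun a _ ha => by rw [(hN t s).2.1 a ha, zero_mul]
  induction n generalizing t with
  | zero => rfl
  | succ n ih =>
    funext s
    simp_rw [hitVec_succ, ih, htrans]

variable [MeasurableSpace S] [DiscreteMeasurableSpace S]

/-- Removing actions does not change the probability with which a remaining policy reaches `B`. -/
lemma Absorbing.reachProb_congr {M N : MDP S A} {B : Set S} (hB : M.Absorbing B)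
    (hact : ∀ s, N.act s ⊆ M.act s) (hP : N.P = M.P) {π : ℕ → S → A → ℝ} (hN : π ∈ N.policies)
    (hM : π ∈ M.policies) (s : S) : N.reachProb B ⟨π, hN⟩ s = M.reachProb B ⟨π, hM⟩ s := by
  have h := (hB.of_act_subset hact hP).tendsto_hitVec ⟨π, hN⟩ s
  simp_rw [hitVec_congr hact hP B hN hM] at h
  exact tendsto_nhds_unique h (hB.tendsto_hitVec ⟨π, hM⟩ s)

/-- Actions that a uniformly optimal stationary policy takes preserve the maximal probability of
reaching `B`. -/
lemma Absorbing.mem_maxActions_of_stationary {M : MDP S A} {B : Set S} (hB : M.Absorbing B)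
    {d : S → A} (hd : ∀ s, d s ∈ M.act s)
    (h : ∀ s, M.reachProb B (M.stationary d hd) s = M.maxReach B s) (s : S) :
    d s ∈ M.maxActions B s := by
  -- Under a stationary policy `hitVec` does not depend on the starting time, so its recursion
  -- passes to an equation for the limit, which is the defining equation of `maxActions`.
  have hstat : ∀ n t s, M.hitVec B (M.stationary d hd) t n s =
      M.hitVec B (M.stationary d hd) 0 n s := by
    intro n
    induction n with
    | zero => exact fun _ _ => rfl
    | succ n ih =>
      intro t s
      simp_rw [hitVec_succ, stationary_trans, ih (t + 1), ih (0 + 1)]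
  refine Finset.mem_filter.2 ⟨hd s, ?_⟩
  have hlim := fun s => hB.tendsto_hitVec (M.stationary d hd) s
  simp_rw [h] at hlim
  refine tendsto_nhds_unique ((Filter.tendsto_add_atTop_iff_nat 1).2 (hlim s)) ?_
  simp_rw [hitVec_succ, stationary_trans, hstat _ (0 + 1)]
  exact tendsto_finsetSum _ fun s' _ => (hlim s').const_mul _

variable [Finite A]

lemma Absorbing.maxReach_le_of_act_subset {M N : MDP S A} {B : Set S} (hB : M.Absorbing B)
    (hM : ∀ s, (M.act s).Nonempty) (hN : ∀ s, (N.act s).Nonempty)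
    (hact : ∀ s, N.act s ⊆ M.act s) (hP : N.P = M.P) (s : S) :
    N.maxReach B s ≤ M.maxReach B s := by
  have : Nonempty N.policies := ⟨N.stationary _ fun s => (hN s).choose_spec⟩
  refine ciSup_le fun π => ?_
  rw [hB.reachProb_congr hact hP π.2 (policies_subset_of_act_subset hact π.2)]
  exact hB.reachProb_le_maxReach hM _ s

lemma Absorbing.maxActions_nonempty {M : MDP S A} {B : Set S} (hB : M.Absorbing B)
    (hM : ∀ s, (M.act s).Nonempty) (s : S) : (M.maxActions B s).Nonempty := by
  obtain ⟨d, hd, h⟩ := hB.exists_stationary hM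
  rw [← hB.maxReach_eq hM] at h
  exact ⟨d s, hB.mem_maxActions_of_stationary hd h s⟩

lemma Absorbing.maxReach_eq_zero_of_mem_zeroStates {M : MDP S A} {B : Set S}
    (hB : M.Absorbing B) (hM : ∀ s, (M.act s).Nonempty) {s : S} (hs : s ∈ M.zeroStates B) :
    M.maxReach B s = 0 := by
  obtain ⟨d, hd, h⟩ := hB.exists_stationary hM
  rw [hB.maxReach_eq hM, ← h]
  exact hs _

/-- The clean-up spares `B` and the zero states, but there every action preserves the maximum
anyway: by absorption on `B`, and on zero states because the expected value lies between 0 and the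
maximum 0. -/
lemma Absorbing.cleaned_act {M : MDP S A} {B : Set S} (hB : M.Absorbing B)
    (hM : ∀ s, (M.act s).Nonempty) (s : S) : (M.cleaned B).act s = M.maxActions B s := by
  ext a
  rw [cleaned, mem_remove_act]
  constructor
  · rintro ⟨ha, h⟩
    by_contra hmax
    refine hmax (Finset.mem_filter.2 ⟨ha, ?_⟩)
    rcases not_not.1 fun hs => h ⟨hs, hmax⟩ with hs | hs
    · rw [hB.sum_P_mul hs ha]
    · have h0 := hB.maxReach_eq_zero_of_mem_zeroStates hM hs
      refine le_antisymm ?_ ?_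
      · rw [h0]
        exact M.sum_P_mul_nonneg s a ((hB.isLeast_maxReach hM (Z := ∅) (by simp)).1.1)
      · conv_rhs => rw [hB.maxReach_eq_bestStep hM]
        exact M.le_bestStep _ ha
  · exact fun ha => ⟨(Finset.mem_filter.1 ha).1, fun h => h.2 ha⟩

lemma Absorbing.modified_act {M : MDP S A} {B : Set S} (hB : M.Absorbing B)
    (hM : ∀ s, (M.act s).Nonempty) (c : S → A → ℝ≥0) (β : Set.Ioo (0 : ℝ) 1) :
    (M.modified B c β).act = M.optActions B c β := by
  funext s
  ext a
  rw [modified, mem_remove_act, hB.cleaned_act hM]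
  constructor
  · rintro ⟨ha, h⟩
    exact not_not.1 fun h' => h ⟨ha, h'⟩
  · exact fun ha => ⟨(Finset.mem_filter.1 ha).1, fun h => h.2 ha⟩

/-- The fixed-point equation of `costValue` is a minimum over a finite nonempty set, hence attained.
-/
lemma Absorbing.optActions_nonempty {M : MDP S A} {B : Set S} (hB : M.Absorbing B)
    (hM : ∀ s, (M.act s).Nonempty) (c : S → A → ℝ≥0) (β : Set.Ioo (0 : ℝ) 1) (s : S) :
    (M.optActions B c β s).Nonempty := by
  obtain ⟨a, ha, h⟩ := (M.costOp_isLeast B c β (M.costValue B c β) s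
    (hB.maxActions_nonempty hM s)).1
  refine ⟨a, Finset.mem_filter.2 ⟨ha, ?_⟩⟩
  rw [(M.costValue_iff B c β _).1 rfl s]
  exact h.symm

end MDP

/-! ### The least-solution claims and the equivalence -/

theorem proposition3 {S A : Type*} [Fintype S] [Finite A]
    [MeasurableSpace S] [DiscreteMeasurableSpace S]
    (M : MDP S A) (hact : ∀ s, (M.act s).Nonempty)
    (B : Set S) (hB : ∀ s ∈ B, ∀ a ∈ M.act s, M.P s a s = 1)
    (c : S → A → ℝ≥0) (β : Set.Ioo (0 : ℝ) 1) :
    -- `x` and `x̄`, the maximal reach probabilities in `M` and in the modified MDP, are the least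
    -- nonnegative solutions of the respective reachability equations
    IsLeast (M.reachSolutions B M.act) (M.maxReach B) ∧
    IsLeast (M.reachSolutions B (M.optActions B c β)) ((M.modified B c β).maxReach B) ∧
    -- the equivalence
    ((∃ π ∈ (M.modified B c β).policies, π ∈ (M.cleaned B).maxReachPolicies B) ↔
      (M.modified B c β).maxReach B M.start = M.maxReach B M.start) := by
  have hM : M.Absorbing B := hB
  let C := M.cleaned B
  let N := M.modified B c β
  have hCact : ∀ s, C.act s ⊆ M.act s := fun s a ha =>
    ((M.mem_remove_act _ s a).1 ha).1
  have hNC : ∀ s, N.act s ⊆ C.act s := fun s a ha =>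
    ((C.mem_remove_act _ s a).1 ha).1
  have hNM : ∀ s, N.act s ⊆ M.act s := fun s => (hNC s).trans (hCact s)
  have hC : C.Absorbing B := hM.of_act_subset hCact rfl
  have hN : N.Absorbing B := hM.of_act_subset hNM rfl
  have hNne : ∀ s, (N.act s).Nonempty := fun s => by
    rw [hM.modified_act hact]
    exact hM.optActions_nonempty hact c β s
  have hCne : ∀ s, (C.act s).Nonempty := fun s => (hNne s).mono (hNC s)
  have hle : ∀ s, N.maxReach B s ≤ M.maxReach B s :=
    hM.maxReach_le_of_act_subset hact hNne hNM rfl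
  have hzero := fun s (hs : s ∈ M.zeroStates B) => hM.maxReach_eq_zero_of_mem_zeroStates hact hs
  refine ⟨hM.isLeast_maxReach hact hzero, ?_, ?_⟩
  · rw [← hM.modified_act hact]
    -- The equations refer to the zero states of `M`, not of `N`; the maximum of `N` vanishes there
    -- because it is at most that of `M`.
    refine hN.isLeast_maxReach hNne fun s hs => le_antisymm ((hle s).trans_eq (hzero s hs)) ?_
    exact (hN.isLeast_maxReach hNne (Z := ∅) (by simp)).1.1 s
  constructor
  · rintro ⟨π, hπN, hπC, hmax⟩
    refine le_antisymm (hle _) ?_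
    obtain ⟨d, hd, h⟩ := hM.exists_stationary hact
    rw [← hM.maxReach_eq hact] at h
    -- The optimal rule of `M` is available in `C`, so a policy optimal in `C` does at least as well
    -- as the optimum of `M`.
    have hdC : ∀ s, d s ∈ C.act s := fun s => by
      rw [hM.cleaned_act hact]
      exact hM.mem_maxActions_of_stationary hd h s
    calc M.maxReach B M.start = M.reachProb B (M.stationary d hd) M.start := (h _).symm
      _ = C.reachProb B (C.stationary d hdC) M.start :=
        (hM.reachProb_congr hCact rfl (C.stationary d hdC).2 (M.stationary d hd).2 _).symm
      _ ≤ C.reachProb B ⟨π, hπC⟩ M.start := hmax _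
      _ = N.reachProb B ⟨π, hπN⟩ M.start := (hC.reachProb_congr hNC rfl hπN hπC _).symm
      _ ≤ N.maxReach B M.start := hN.reachProb_le_maxReach hNne _ _
  · intro heq
    -- The witness attains the maximum of `N`; by `heq` this is the maximum of `M`, which bounds
    -- every policy of `C`.
    obtain ⟨d, hd, h⟩ := hN.exists_stationary hNne
    rw [← hN.maxReach_eq hNne] at h
    have hdC := MDP.policies_subset_of_act_subset hNC (N.stationary d hd).2
    refine ⟨_, (N.stationary d hd).2, hdC, fun π => ?_⟩
    calc C.reachProb B π M.start ≤ C.maxReach B M.start := hC.reachProb_le_maxReach hCne _ _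
      _ ≤ M.maxReach B M.start := hM.maxReach_le_of_act_subset hact hCne hCact rfl _
      _ = N.maxReach B M.start := heq.symm
      _ = N.reachProb B (N.stationary d hd) M.start := (h _).symm
      _ = C.reachProb B ⟨_, hdC⟩ M.start := hC.reachProb_congr hNC rfl _ hdC _
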